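/- Let $f$ be a probability density on $\mathbb{R}^d$ and, for $t\in\mathbb{R}$, let $G(t)=\{x\in\mathbb{R}^d: f(x)\ge t\}$. Let $p\ge 1$ be an integer and let $-\infty<l\le u<\sup f<\infty$. Assume that for every $t\in[l,u]$ the level set $G(t)$ is compact, nonempty and nonconvex, and that the following conditions hold. (A) There are $\zeta>0$ and a bounded open set $U$ containing $\overline{G(l-\zeta)}\setminus\operatorname{int}(G(u+\zeta))$ such that $G(u+\zeta)$ is bounded, $f\in\mathcal{C}^p(U)$ and, for some constants $m>0$ and $k$, $|\nabla f(x)|\ge m$ and $|\nabla f(x)-\nabla f(y)|\le k|x-y|$ for all $x,y\in U$. (K) $K:\mathbb{R}^d\to\mathbb{R}$ is a continuous kernel with bounded support and finite (total) variation, of order at least $p$; that is, $\int K=1$ and $\int z^\alpha K(z)\,dz=0$ for every multi-index $\alpha$ with $1\le|\alpha|\le p-1$. The bandwidths $h=h_n$ are positive for large $n$ and of exact order $(\log n/n)^{1/(d+2p)}$; that is, $h_n/(\log n/n)^{1/(d+2p)}$ is bounded and bounded away from $0$ for large $n$. Let $X_1,X_2,\dots$ be independent random vectors with density $f$, $\mathcal{X}_n=\{X_1,\dots,X_n\}$,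 and let $f_n(x)=\frac{1}{nh_n^d}\sum_{i=1}^n K\left(\frac{x-X_i}{h_n}\right)$ be the kernel density estimator. For $M>0$ let $D_n=M(\log n/n)^{p/(d+2p)}$ and $$\mathcal{X}_n^+(t)=\{X\in\mathcal{X}_n: f_n(X)\ge t+D_n\}.$$ Then there is $M_0>0$, depending only on $d,p,f,l,u,K$ and $(h_n)$, such that for every $M\ge M_0$ and every $\epsilon>0$, $$\mathbb{P}\Big(\sup_{t\in[l,u]}\ \sup_{x\in G(t)} d\big(x,\mathcal{X}_n^+(t)\big)\le\epsilon \text{ eventually}\Big)=1,$$ where $d(x,A)=\inf_{a\in A}\|x-a\|$, $d(x,\emptyset)=+\infty$, and "eventually" means for all sufficiently large $n$. In particular, with probability one, $\mathcal{X}_n^+(t)\neq\emptyset$ for all $t\in[l,u]$ and all sufficiently large $n$. -/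

import Mathlib

open MeasureTheory ProbabilityTheory Filter Asymptotics Set
open scoped ENNReal Topology

noncomputable section

namespace LevelSetEstimation

/-- `f` is a probability density on `ℝᵈ` with respect to Lebesgue measure. -/
structure IsDensity {d : ℕ} (f : EuclideanSpace ℝ (Fin d) → ℝ) : Prop where
  measurable : Measurable f
  nonneg : ∀ x, 0 ≤ f x
  lintegral_eq_one : ∫⁻ x, ENNReal.ofReal (f x) = 1

/-- The level set `G(t) = {x : f x ≥ t}`. -/
def levelSet {d : ℕ} (f : EuclideanSpace ℝ (Fin d) → ℝ) (t : ℝ) :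
    Set (EuclideanSpace ℝ (Fin d)) :=
  {x | t ≤ f x}

/-- Assumption (A) on the density `f`, the range of levels `[l, u]` and the smoothness `p`. -/
structure AssumptionA {d : ℕ} (f : EuclideanSpace ℝ (Fin d) → ℝ) (l u : ℝ) (p : ℕ) : Prop where
  l_le_u : l ≤ u
  bddAbove : BddAbove (range f)
  u_lt_sup : u < ⨆ x, f x
  one_le_p : 1 ≤ p
  regular : ∃ ζ > 0, ∃ U : Set (EuclideanSpace ℝ (Fin d)),
    IsOpen U ∧ Bornology.IsBounded U ∧
    closure (levelSet f (l - ζ)) \ interior (levelSet f (u + ζ)) ⊆ U ∧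
    Bornology.IsBounded (levelSet f (u + ζ)) ∧
    ContDiffOn ℝ p f U ∧
    (∃ m > 0, ∀ x ∈ U, m ≤ ‖gradient f x‖) ∧
    (∃ k : ℝ, ∀ x ∈ U, ∀ y ∈ U, ‖gradient f x - gradient f y‖ ≤ k * ‖x - y‖)

/-- The divergence of a vector field on `ℝᵈ`. -/
def divergence {d : ℕ} (φ : EuclideanSpace ℝ (Fin d) → EuclideanSpace ℝ (Fin d))
    (x : EuclideanSpace ℝ (Fin d)) : ℝ :=
  ∑ i, fderiv ℝ φ x (EuclideanSpace.single i 1) i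

/-- Finite total variation on `ℝᵈ`: the supremum of `∫ K div φ` over the smooth compactly
supported vector fields `φ` with `|φ| ≤ 1` is finite. -/
def HasFiniteVariation {d : ℕ} (K : EuclideanSpace ℝ (Fin d) → ℝ) : Prop :=
  ∃ V : ℝ, ∀ φ : EuclideanSpace ℝ (Fin d) → EuclideanSpace ℝ (Fin d),
    ContDiff ℝ ((⊤ : ℕ∞) : WithTop ℕ∞) φ → HasCompactSupport φ → (∀ x, ‖φ x‖ ≤ 1) →
    ∫ x, K x * divergence φ x ≤ V

/-- `K` is a kernel of order at least `p`: it has integral one, and its moments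
`∫ zᵅ K(z) dz` vanish for all multi-indices `α` with `1 ≤ |α| ≤ p - 1`. -/
structure HasOrderAtLeast {d : ℕ} (K : EuclideanSpace ℝ (Fin d) → ℝ) (p : ℕ) : Prop where
  integrable : Integrable K
  integral_eq_one : ∫ z, K z = 1
  moment_eq_zero : ∀ α : Fin d → ℕ, 1 ≤ ∑ i, α i → ∑ i, α i < p →
    Integrable (fun z => (∏ i, z i ^ α i) * K z) ∧ ∫ z, (∏ i, z i ^ α i) * K z = 0

/-- Assumption (K) on the kernel `K` and the bandwidth sequence `h`. -/
structure AssumptionK {d : ℕ} (K : EuclideanSpace ℝ (Fin d) → ℝ) (h : ℕ → ℝ) (p : ℕ) :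
    Prop where
  continuous : Continuous K
  order : HasOrderAtLeast K p
  bounded_support : Bornology.IsBounded (Function.support K)
  finite_variation : HasFiniteVariation K
  bandwidth_pos : ∀ᶠ n in atTop, 0 < h n
  bandwidth_order :
    h =Θ[atTop] fun n : ℕ => (Real.log n / n) ^ ((1 : ℝ) / ((d : ℝ) + 2 * (p : ℝ)))

/-- The sequence `Dₙ = M (log n / n)^(p / (d + 2p))`. -/
def gap (d p : ℕ) (M : ℝ) (n : ℕ) : ℝ :=
  M * (Real.log n / n) ^ ((p : ℝ) / ((d : ℝ) + 2 * (p : ℝ)))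

/-- The kernel density estimator at `x`, from the first `n` of the points `X 0, X 1, …`, with
bandwidth `b`. -/
def kernelEstimator {d : ℕ} (K : EuclideanSpace ℝ (Fin d) → ℝ) (b : ℝ)
    (X : ℕ → EuclideanSpace ℝ (Fin d)) (n : ℕ) (x : EuclideanSpace ℝ (Fin d)) : ℝ :=
  1 / ((n : ℝ) * b ^ d) * ∑ i ∈ Finset.range n, K (b⁻¹ • (x - X i))

/-- The subsample `𝒳ₙ⁺(t) = {X ∈ 𝒳ₙ : fₙ(X) ≥ t + D}` of `𝒳ₙ = {X 0, …, X (n - 1)}`, where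
`fₙ` is the kernel estimator with bandwidth `b`. -/
def plusSample {d : ℕ} (K : EuclideanSpace ℝ (Fin d) → ℝ) (b D : ℝ)
    (X : ℕ → EuclideanSpace ℝ (Fin d)) (n : ℕ) (t : ℝ) : Set (EuclideanSpace ℝ (Fin d)) :=
  {x | (∃ i < n, X i = x) ∧ t + D ≤ kernelEstimator K b X n x}

/-- `X 0, X 1, …` are independent random vectors, each with density `f`. -/
structure IsRandomSample {d : ℕ} {Ω : Type*} [MeasurableSpace Ω] (P : Measure Ω)
    (X : ℕ → Ω → EuclideanSpace ℝ (Fin d)) (f : EuclideanSpace ℝ (Fin d) → ℝ) : Prop where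
  measurable : ∀ i, Measurable (X i)
  indep : iIndepFun X P
  law : ∀ i, P.map (X i) = volume.withDensity fun x => ENNReal.ofReal (f x)

end LevelSetEstimation

end

/-! Almost surely `fₙ(Xᵢ) → f(Xᵢ)` simultaneously at the countably many sample points. Indeed, at
a fixed Lebesgue point of `f` the convergence `fₙ(x) → f(x)` follows from Lebesgue differentiation
for the bias and from Bernstein's inequality with Borel–Cantelli for the deviation; replacing the
single observation `Xᵢ` does not change the limit, so `Xᵢ` may be treated as independent of `fₙ`,
and by Fubini its value may be taken for `x`.

The sample points with `f > t` are almost surely dense in the support of the law restricted to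
`{f > t}`. This support contains `G(t)`: a point of `G(t)` is either interior to `{f > t}` or in
`U`, where `∇f ≠ 0` excludes local maxima. Since `Dₙ → 0`, each `x ∈ G(t)` thus has a nearby sample
point that eventually belongs to `𝒳ₙ⁺(s)` for all `s` close to `t`, and compactness of
`{(x, t) : t ∈ [l, u], x ∈ G(t)}` makes this uniform in `t` and `x`. -/

namespace LevelSetEstimation

section Concentration

variable {Ω : Type*} [MeasurableSpace Ω] {P : Measure Ω} [IsProbabilityMeasure P]

theorem mgf_sub_integral_le_exp {Y : Ω → ℝ} (hY : Measurable Y) {B c : ℝ}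
    (hB : ∀ ω, |Y ω| ≤ B) (hc : |c| * (2 * B) ≤ 1) :
    mgf (fun ω => Y ω - P[Y]) P c ≤ Real.exp (c ^ 2 * Var[Y; P]) := by
  have hint : Integrable Y P := .of_bound hY.aestronglyMeasurable B (ae_of_all _ hB)
  have hmean : |P[Y]| ≤ B := by
    simpa using norm_integral_le_of_norm_le_const (f := Y) (ae_of_all P hB)
  have hcen : ∀ ω, |Y ω - P[Y]| ≤ 2 * B := fun ω => by
    linarith [abs_sub (Y ω) P[Y], hB ω]
  have hsmall : ∀ ω, |c * (Y ω - P[Y])| ≤ 1 := fun ω => by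
    rw [abs_mul]
    exact (mul_le_mul_of_nonneg_left (hcen ω) (abs_nonneg c)).trans hc
  have hint₁ : Integrable (fun ω => Y ω - P[Y]) P := hint.sub (integrable_const _)
  have hint₂ : Integrable (fun ω => (Y ω - P[Y]) ^ 2) P := by
    refine .of_bound (by fun_prop) ((2 * B) ^ 2) (ae_of_all _ fun ω => ?_)
    rw [Real.norm_eq_abs, abs_pow]
    exact pow_le_pow_left₀ (abs_nonneg _) (hcen ω) 2
  have hlin : Integrable (fun ω => 1 + c * (Y ω - P[Y])) P :=
    (integrable_const 1).add (hint₁.const_mul c)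
  have hquad : Integrable (fun ω => c ^ 2 * (Y ω - P[Y]) ^ 2) P := hint₂.const_mul _
  calc mgf (fun ω => Y ω - P[Y]) P c
      ≤ ∫ ω, (1 + c * (Y ω - P[Y]) + c ^ 2 * (Y ω - P[Y]) ^ 2) ∂P := by
        refine integral_mono_of_nonneg (ae_of_all _ fun ω => (Real.exp_pos _).le)
          (hlin.add hquad) (ae_of_all _ fun ω => ?_)
        have := (abs_le.1 (Real.abs_exp_sub_one_sub_id_le (hsmall ω))).2
        linarith [mul_pow c (Y ω - P[Y]) 2]
    _ = 1 + c ^ 2 * Var[Y; P] := by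
        rw [integral_add hlin hquad, integral_add (integrable_const 1) (hint₁.const_mul c),
          integral_const_mul, integral_const_mul, integral_sub hint (integrable_const _),
          variance_eq_integral hY.aemeasurable]
        simp
    _ ≤ Real.exp (c ^ 2 * Var[Y; P]) := by linarith [Real.add_one_le_exp (c ^ 2 * Var[Y; P])]

theorem measureReal_le_sum_sub_integral_le {ι : Type*} {Y : ι → Ω → ℝ}
    (hind : iIndepFun Y P) (hY : ∀ i, Measurable (Y i)) {B c : ℝ} (hB : ∀ i ω, |Y i ω| ≤ B)
    (hc₀ : 0 ≤ c) (hc : c * (2 * B) ≤ 1) (s : Finset ι) (ε : ℝ) :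
    P.real {ω | ε ≤ ∑ i ∈ s, (Y i ω - P[Y i])} ≤
      Real.exp (c ^ 2 * ∑ i ∈ s, Var[Y i; P] - c * ε) := by
  have hcen : iIndepFun (fun i ω => Y i ω - P[Y i]) P :=
    hind.comp (fun i y => y - ∫ ω, Y i ω ∂P) fun i => measurable_id.sub_const _
  have hmeas : ∀ i, Measurable fun ω => Y i ω - P[Y i] := fun i => (hY i).sub_const _
  have hbound : ∀ ω, ∑ i ∈ s, (Y i ω - P[Y i]) ≤ ∑ i ∈ s, (B - P[Y i]) := fun ω =>
    Finset.sum_le_sum fun i _ => sub_le_sub_right ((le_abs_self _).trans (hB i ω)) _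
  have hint : Integrable (fun ω => Real.exp (c * ∑ i ∈ s, (Y i ω - P[Y i]))) P := by
    refine .of_bound (by fun_prop) (Real.exp (c * ∑ i ∈ s, (B - P[Y i])))
      (ae_of_all _ fun ω => ?_)
    rw [Real.norm_eq_abs, Real.abs_exp]
    exact Real.exp_le_exp.2 (mul_le_mul_of_nonneg_left (hbound ω) hc₀)
  calc P.real {ω | ε ≤ ∑ i ∈ s, (Y i ω - P[Y i])}
      ≤ Real.exp (-c * ε) * mgf (fun ω => ∑ i ∈ s, (Y i ω - P[Y i])) P c :=
        measure_ge_le_exp_mul_mgf ε hc₀ hint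
    _ = Real.exp (-c * ε) * ∏ i ∈ s, mgf (fun ω => Y i ω - P[Y i]) P c := by
        rw [← hcen.mgf_sum hmeas s]
        simp only [Finset.sum_fn]
    _ ≤ Real.exp (-c * ε) * ∏ i ∈ s, Real.exp (c ^ 2 * Var[Y i; P]) := by
        gcongr with i
        · exact fun i _ => mgf_nonneg
        · exact mgf_sub_integral_le_exp (hY i) (hB i) (by rwa [abs_of_nonneg hc₀])
    _ = Real.exp (c ^ 2 * ∑ i ∈ s, Var[Y i; P] - c * ε) := by
        rw [← Real.exp_sum, ← Real.exp_add, Finset.mul_sum]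
        ring_nf

theorem measureReal_le_abs_sum_sub_integral_le {ι : Type*} {Y : ι → Ω → ℝ}
    (hind : iIndepFun Y P) (hY : ∀ i, Measurable (Y i)) {B c : ℝ} (hB : ∀ i ω, |Y i ω| ≤ B)
    (hc₀ : 0 ≤ c) (hc : c * (2 * B) ≤ 1) (s : Finset ι) (ε : ℝ) :
    P.real {ω | ε ≤ |∑ i ∈ s, (Y i ω - P[Y i])|} ≤
      2 * Real.exp (c ^ 2 * ∑ i ∈ s, Var[Y i; P] - c * ε) := by
  have hupper := measureReal_le_sum_sub_integral_le hind hY hB hc₀ hc s ε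
  have hlower := measureReal_le_sum_sub_integral_le
    (hind.comp (fun _ y => -y) fun _ => measurable_neg) (fun i => (hY i).neg)
    (fun i ω => by simpa using hB i ω) hc₀ hc s ε
  simp only [Function.comp_def, integral_neg, variance_fun_neg] at hlower
  have hsplit : {ω | ε ≤ |∑ i ∈ s, (Y i ω - P[Y i])|} ⊆
      {ω | ε ≤ ∑ i ∈ s, (Y i ω - P[Y i])} ∪ {ω | ε ≤ ∑ i ∈ s, (-Y i ω - -P[Y i])} := by
    intro ω hω
    refine (le_abs.1 (mem_ofPred_eq ▸ hω)).imp_right fun hle => ?_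
    simpa only [mem_ofPred_eq, ← neg_sub', Finset.sum_neg_distrib] using hle
  linarith [measureReal_mono (μ := P) hsplit, measureReal_union_le (μ := P)
    {ω | ε ≤ ∑ i ∈ s, (Y i ω - P[Y i])} {ω | ε ≤ ∑ i ∈ s, (-Y i ω - -P[Y i])}]

theorem ae_eventually_abs_sum_sub_integral_lt {Y : ℕ → ℕ → Ω → ℝ}
    (hind : ∀ n, iIndepFun (Y n) P) (hY : ∀ n i, Measurable (Y n i)) {B : ℝ}
    (hB : ∀ n i ω, |Y n i ω| ≤ B) {a : ℕ → ℝ}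
    (hvar : (fun n => ∑ i ∈ Finset.range n, Var[Y n i; P]) =O[atTop] a)
    (hlog : (fun n : ℕ => Real.log n) =o[atTop] a) {η : ℝ} (hη : 0 < η) :
    ∀ᵐ ω ∂P, ∀ᶠ n in atTop,
      |∑ i ∈ Finset.range n, (Y n i ω - P[Y n i])| < η * |a n| := by
  obtain ⟨C, hvarC⟩ := hvar.bound
  obtain ⟨c, hc, hcB, hcC⟩ : ∃ c > 0, c * (2 * B) ≤ 1 ∧ c * C ≤ η / 2 := by
    have hsmall (A : ℝ) {δ : ℝ} (hδ : 0 < δ) : ∀ᶠ c in 𝓝[>] (0 : ℝ), c * A ≤ δ := by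
      have : Tendsto (fun c : ℝ => c * A) (𝓝[>] 0) (𝓝 (0 * A)) :=
        (continuous_mul_const A).continuousWithinAt
      exact (this.eventually_lt_const (by simpa)).mono fun _ => le_of_lt
    exact (eventually_mem_nhdsWithin.and
      ((hsmall (2 * B) one_pos).and (hsmall C (half_pos hη)))).exists
  let S n := {ω | η * |a n| ≤ |∑ i ∈ Finset.range n, (Y n i ω - P[Y n i])|}
  have hS : ∀ᶠ n : ℕ in atTop, P.real (S n) ≤ 2 * ((n : ℝ) ^ 2)⁻¹ := by
    filter_upwards [hvarC, hlog.bound (show 0 < c * η / 4 by positivity),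
      eventually_gt_atTop 0] with n hv hl hn
    rw [Real.norm_eq_abs, Real.norm_eq_abs] at hv hl
    have hexp : c ^ 2 * ∑ i ∈ Finset.range n, Var[Y n i; P] - c * (η * |a n|) ≤
        -(2 * Real.log n) := by
      have hCa : c * (c * (C * |a n|)) ≤ c * (η / 2 * |a n|) := by
        rw [← mul_assoc c C]
        gcongr
      have hva := mul_le_mul_of_nonneg_left ((le_abs_self _).trans hv) (sq_nonneg c)
      linarith [le_abs_self (Real.log n)]
    calc P.real (S n)
        ≤ 2 * Real.exp (c ^ 2 * ∑ i ∈ Finset.range n, Var[Y n i; P] - c * (η * |a n|)) :=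
          measureReal_le_abs_sum_sub_integral_le (hind n) (hY n) (hB n) hc.le hcB _ _
      _ ≤ 2 * Real.exp (-(2 * Real.log n)) := by gcongr
      _ = 2 * ((n : ℝ) ^ 2)⁻¹ := by
          rw [Real.exp_neg, ← Nat.cast_ofNat, Real.exp_nat_mul, Real.exp_log (by positivity)]
  have hsum : Summable fun n => P.real (S n) := by
    refine .of_norm_bounded_eventually_nat
      ((Real.summable_nat_pow_inv.2 one_lt_two).mul_left 2) ?_
    filter_upwards [hS] with n hn
    rwa [Real.norm_of_nonneg measureReal_nonneg]
  have hfin : ∑' n, P (S n) ≠ ∞ := by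
    simpa only [ofReal_measureReal (measure_ne_top P _)] using hsum.tsum_ofReal_ne_top
  filter_upwards [ae_eventually_notMem hfin] with ω hω
  exact hω.mono fun n hn => not_le.1 hn

theorem ae_tendsto_sum_sub_integral_div {Y : ℕ → ℕ → Ω → ℝ}
    (hind : ∀ n, iIndepFun (Y n) P) (hY : ∀ n i, Measurable (Y n i)) {B : ℝ}
    (hB : ∀ n i ω, |Y n i ω| ≤ B) {a : ℕ → ℝ}
    (hvar : (fun n => ∑ i ∈ Finset.range n, Var[Y n i; P]) =O[atTop] a)
    (hlog : (fun n : ℕ => Real.log n) =o[atTop] a) :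
    ∀ᵐ ω ∂P, Tendsto (fun n => (∑ i ∈ Finset.range n, (Y n i ω - P[Y n i])) / a n)
      atTop (𝓝 0) := by
  have hk : ∀ᵐ ω ∂P, ∀ k : ℕ, ∀ᶠ n in atTop,
      |∑ i ∈ Finset.range n, (Y n i ω - P[Y n i])| < 1 / ((k : ℝ) + 1) * |a n| :=
    ae_all_iff.2 fun k =>
      ae_eventually_abs_sum_sub_integral_lt hind hY hB hvar hlog (by positivity)
  filter_upwards [hk] with ω hω
  refine IsLittleO.tendsto_div_nhds_zero (.of_bound fun η hη => ?_)
  obtain ⟨k, hkη⟩ := exists_nat_one_div_lt hη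
  filter_upwards [hω k] with n hn
  exact hn.le.trans (mul_le_mul_of_nonneg_right hkη.le (abs_nonneg _))

end Concentration

section Sampling

variable {Ω E : Type*} [MeasurableSpace Ω] [MeasurableSpace E] {P : Measure Ω}
  [IsProbabilityMeasure P] {μ : Measure E} {X : ℕ → Ω → E}

theorem ae_exists_mem_of_measure_ne_zero (hX : ∀ i, Measurable (X i)) (hind : iIndepFun X P)
    (hlaw : ∀ i, P.map (X i) = μ) {S : Set E} (hS : MeasurableSet S) (hμS : μ S ≠ 0) :
    ∀ᵐ ω ∂P, ∃ i, X i ω ∈ S := by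
  have hmeas : ∀ i, MeasurableSet (X i ⁻¹' S) := fun i => hX i hS
  have hindS : iIndepSet (fun i => X i ⁻¹' S) P :=
    (iIndepSet_iff_meas_biInter hmeas).2 fun s =>
      hind.measure_inter_preimage_eq_mul s fun _ _ => hS
  have hdiv : ∑' i, P (X i ⁻¹' S) = ∞ := by
    simp only [← Measure.map_apply (hX _) hS, hlaw]
    exact ENNReal.tsum_const_eq_top_of_ne_zero hμS
  have hio : ∀ᵐ ω ∂P, ω ∈ limsup (fun i => X i ⁻¹' S) atTop :=
    (prob_compl_eq_zero_iff (MeasurableSet.measurableSet_limsup hmeas)).2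
      (measure_limsup_eq_one hmeas hindS hdiv)
  filter_upwards [hio] with ω hω
  exact (mem_limsup_iff_frequently_mem.1 hω).exists

theorem ae_forall_isOpen_exists_mem [TopologicalSpace E] [SecondCountableTopology E]
    [OpensMeasurableSpace E] (hX : ∀ i, Measurable (X i)) (hind : iIndepFun X P)
    (hlaw : ∀ i, P.map (X i) = μ) :
    ∀ᵐ ω ∂P, ∀ O, IsOpen O → μ O ≠ 0 → ∃ i, X i ω ∈ O := by
  have hbasis := TopologicalSpace.isBasis_countableBasis E
  have hae : ∀ᵐ ω ∂P, ∀ V ∈ TopologicalSpace.countableBasis E, μ V ≠ 0 → ∃ i, X i ω ∈ V := by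
    rw [ae_ball_iff (TopologicalSpace.countable_countableBasis E)]
    exact fun V hV => eventually_imp_distrib_left.2
      (ae_exists_mem_of_measure_ne_zero hX hind hlaw (hbasis.isOpen hV).measurableSet)
  filter_upwards [hae] with ω hω O hO hμO
  obtain ⟨x, hxO, hx⟩ := Measure.nonempty_inter_support_of_pos (pos_iff_ne_zero.2 hμO)
  obtain ⟨V, hV, hxV, hVO⟩ := hbasis.exists_subset_of_mem_open hxO hO
  have hμV := (Measure.mem_support_iff_forall x).1 hx V ((hbasis.isOpen hV).mem_nhds hxV)
  exact (hω V hV hμV.ne').imp fun i hi => hVO hi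

theorem ae_forall_support_restrict_subset_closure_image [TopologicalSpace E]
    [SecondCountableTopology E] [OpensMeasurableSpace E] (hX : ∀ i, Measurable (X i))
    (hind : iIndepFun X P) (hlaw : ∀ i, P.map (X i) = μ) {f : E → ℝ} (hf : Measurable f) :
    ∀ᵐ ω ∂P, ∀ t, (μ.restrict {x | t < f x}).support ⊆
      closure ((fun i => X i ω) '' {i | t < f (X i ω)}) := by
  -- Passing to the points `(X i, f (X i))` turns `t < f (X i)` into an open condition, so that a
  -- single null set serves all levels `t`.
  have hgraph : Measurable fun x => (x, f x) := measurable_id.prodMk hf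
  have hae := ae_forall_isOpen_exists_mem (μ := μ.map fun x => (x, f x))
    (X := fun i ω => (X i ω, f (X i ω))) (fun i => hgraph.comp (hX i))
    (hind.comp (fun _ x => (x, f x)) fun _ => hgraph)
    fun i => by rw [← hlaw i, Measure.map_map hgraph (hX i)]; rfl
  filter_upwards [hae] with ω hω t x hx
  refine mem_closure_iff.2 fun O hO hxO => ?_
  have hpos : μ (O ∩ {y | t < f y}) ≠ 0 := by
    rw [← Measure.restrict_apply hO.measurableSet]
    exact ((Measure.mem_support_iff_forall x).1 hx O (hO.mem_nhds hxO)).ne'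
  obtain ⟨i, hi⟩ := hω (O ×ˢ Ioi t) (hO.prod isOpen_Ioi) (by
    rwa [Measure.map_apply hgraph (hO.prod isOpen_Ioi).measurableSet])
  exact ⟨X i ω, hi.1, i, hi.2, rfl⟩

end Sampling

section Independence

variable {Ω α β : Type*} [MeasurableSpace Ω] [MeasurableSpace α] [MeasurableSpace β]
  {P : Measure Ω}

theorem ae_prodMk_mem_of_indepFun [IsFiniteMeasure P] {Y : Ω → α} {Z : Ω → β}
    (hY : Measurable Y) (hZ : Measurable Z) (hind : IndepFun Y Z P) {A : Set (α × β)}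
    (hA : MeasurableSet A) (h : ∀ᵐ y ∂P.map Y, ∀ᵐ ω ∂P, (y, Z ω) ∈ A) :
    ∀ᵐ ω ∂P, (Y ω, Z ω) ∈ A := by
  have hprod : ∀ᵐ q ∂(P.map Y).prod (P.map Z), q ∈ A := by
    refine (Measure.ae_prod_iff_ae_ae hA).2 ?_
    exact h.mono fun y hy => (ae_map_iff hZ.aemeasurable (measurable_prodMk_left hA)).2 hy
  rw [← (indepFun_iff_map_prod_eq_prod_map_map hY.aemeasurable hZ.aemeasurable).1 hind] at hprod
  exact ae_of_ae_map (hY.prodMk hZ).aemeasurable hprod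

theorem indepFun_update {ι : Type*} [DecidableEq ι] {X : ι → Ω → α} (hX : ∀ i, Measurable (X i))
    (hind : iIndepFun X P) (i : ι) (c : α) :
    IndepFun (X i) (fun ω => Function.update (fun j => X j ω) i c) P := by
  have hdisj := indep_iSup_of_disjoint (fun j => (hX j).comap_le) hind.iIndep
    (disjoint_compl_right (a := ({i} : Set ι)))
  rw [iSup_singleton] at hdisj
  refine (IndepFun_iff_Indep _ _ _).2 (indep_of_indep_of_le_right hdisj ?_)
  simp only [MeasurableSpace.pi, MeasurableSpace.comap_iSup, MeasurableSpace.comap_comp,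
    Function.comp_def]
  refine iSup_le fun j => ?_
  rcases eq_or_ne j i with rfl | hj
  · simp only [Function.update_self, MeasurableSpace.comap_const, bot_le]
  · simp only [Function.update_of_ne hj]
    exact le_iSup₂_of_le (f := fun k (_ : k ∈ ({i} : Set ι)ᶜ) => _) j hj le_rfl

end Independence

section Smoothing

theorem support_comp_inv_smul_sub_subset {E : Type*} [NormedAddCommGroup E] [NormedSpace ℝ E]
    {K : E → ℝ} {R b : ℝ} (hR : Function.support K ⊆ Metric.closedBall 0 R) (hb : 0 < b)
    (x : E) : (Function.support fun y => K (b⁻¹ • (x - y))) ⊆ Metric.closedBall x (b * R) := by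
  intro y hy
  have hxy := mem_closedBall_zero_iff.1 (hR hy)
  rwa [norm_smul, norm_inv, Real.norm_of_nonneg hb.le, inv_mul_le_iff₀ hb,
    ← mem_closedBall_iff_norm, Metric.mem_closedBall_comm] at hxy

variable {E : Type*} [NormedAddCommGroup E] [MeasurableSpace E]

/-- A bounded measurable function with bounded support, as used for kernel smoothing: rescaled
around a Lebesgue point of a function, it reproduces the value of that function. -/
structure IsBoundedKernel (K : E → ℝ) : Prop where
  measurable : Measurable K
  bounded : ∃ B, ∀ z, |K z| ≤ B
  bounded_support : Bornology.IsBounded (Function.support K)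

theorem IsBoundedKernel.sq {K : E → ℝ} (hK : IsBoundedKernel K) :
    IsBoundedKernel fun z => K z ^ 2 where
  measurable := hK.measurable.pow_const 2
  bounded := by
    obtain ⟨B, hB⟩ := hK.bounded
    refine ⟨B ^ 2, fun z => ?_⟩
    rw [abs_pow]
    exact pow_le_pow_left₀ (abs_nonneg _) (hB z) 2
  bounded_support := hK.bounded_support.subset fun z hz => by
    simpa using hz

theorem IsBoundedKernel.integrable [ProperSpace E] {μ : Measure E} [IsFiniteMeasureOnCompacts μ]
    {K : E → ℝ} (hK : IsBoundedKernel K) : Integrable K μ := by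
  obtain ⟨B, hB⟩ := hK.bounded
  rw [← integrableOn_iff_integrable_of_support_subset subset_closure]
  exact .of_bound hK.bounded_support.isCompact_closure.measure_lt_top
    hK.measurable.aestronglyMeasurable B (ae_of_all _ hB)

theorem IsBoundedKernel.integral_sq_ne_zero [ProperSpace E] {μ : Measure E}
    [IsFiniteMeasureOnCompacts μ] {K : E → ℝ} (hK : IsBoundedKernel K)
    (hK₀ : ∫ z, K z ∂μ ≠ 0) : ∫ z, K z ^ 2 ∂μ ≠ 0 := by
  contrapose! hK₀
  have hsq := (integral_eq_zero_iff_of_nonneg (fun z => sq_nonneg (K z)) hK.sq.integrable).1 hK₀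
  exact integral_eq_zero_of_ae (hsq.mono fun z hz => pow_eq_zero_iff two_ne_zero |>.1 hz)

variable [NormedSpace ℝ E] [FiniteDimensional ℝ E] [BorelSpace E]
  {μ : Measure E} [μ.IsAddHaarMeasure]

theorem integral_comp_inv_smul_sub (K : E → ℝ) {b : ℝ} (hb : 0 ≤ b) (x : E) :
    ∫ y, K (b⁻¹ • (x - y)) ∂μ = b ^ Module.finrank ℝ E * ∫ z, K z ∂μ :=
  (integral_sub_left_eq_self (fun z => K (b⁻¹ • z)) μ x).trans
    (Measure.integral_comp_inv_smul_of_nonneg μ K hb)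

theorem IsBoundedKernel.ae_tendsto_inv_pow_mul_integral {K : E → ℝ} (hK : IsBoundedKernel K)
    (hK₀ : ∫ z, K z ∂μ ≠ 0) {f : E → ℝ} (hf : LocallyIntegrable f μ) {ι : Type*}
    {L : Filter ι} {b : ι → ℝ} (hb : Tendsto b L (𝓝[>] 0)) :
    ∀ᵐ x ∂μ, Tendsto (fun i => (b i ^ Module.finrank ℝ E)⁻¹ *
      ∫ y, K ((b i)⁻¹ • (x - y)) * f y ∂μ) L (𝓝 ((∫ z, K z ∂μ) * f x)) := by
  obtain ⟨B, hB⟩ := hK.bounded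
  obtain ⟨R, hR₀, hR⟩ := hK.bounded_support.subset_closedBall_lt 0 0
  set N := Module.finrank ℝ E
  set m := ∫ z, K z ∂μ
  have hpos : ∀ᶠ i in L, 0 < b i := (tendsto_nhdsWithin_iff.1 hb).2
  have hbR : Tendsto (fun i => b i * R) L (𝓝[>] 0) := by
    refine tendsto_nhdsWithin_iff.2 ⟨?_, hpos.mono fun i hi => mul_pos hi hR₀⟩
    simpa using (tendsto_nhds_of_tendsto_nhdsWithin hb).mul_const R
  have hV : 0 < μ.real (Metric.closedBall 0 R) :=
    ENNReal.toReal_pos (Metric.measure_closedBall_pos μ 0 hR₀).ne' measure_closedBall_lt_top.ne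
  have hball (x : E) (i) (hi : 0 < b i) : μ.real (Metric.closedBall x (b i * R)) =
      b i ^ N * μ.real (Metric.closedBall 0 R) := by
    rw [measureReal_def, Measure.addHaar_closedBall_mul_of_pos μ x hi, ENNReal.toReal_mul,
      ENNReal.toReal_ofReal (pow_pos hi N).le, measureReal_def]
  filter_upwards [IsUnifLocDoublingMeasure.ae_tendsto_average_norm_sub μ hf 1] with x hx
  have havg := hx (fun _ => x) (fun i => b i * R) hbR <| hpos.mono fun i hi =>
    Metric.mem_closedBall_self (by positivity)
  have hlim : Tendsto (fun i => ∫ y, ((b i ^ N * m)⁻¹ * K ((b i)⁻¹ • (x - y))) • f y ∂μ)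
      L (𝓝 (f x)) := by
    refine tendsto_integral_smul_of_tendsto_average_norm_sub
      (B * |m|⁻¹ * μ.real (Metric.closedBall 0 R)) havg
      (.of_forall fun i => hf.integrableOn_isCompact (isCompact_closedBall _ _))
      (tendsto_const_nhds.congr' (hpos.mono fun i hi => Eq.symm ?_))
      (hpos.mono fun i hi => ?_) (hpos.mono fun i hi y => ?_)
    · beta_reduce
      rw [integral_const_mul, integral_comp_inv_smul_sub K hi.le,
        inv_mul_cancel₀ (mul_ne_zero (pow_pos hi N).ne' hK₀)]
    · exact (Function.support_mul_subset_right _ _).trans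
        (support_comp_inv_smul_sub_subset hR hi x)
    · rw [hball x i hi, abs_mul, abs_inv, abs_mul, abs_of_pos (pow_pos hi N),
        mul_div_mul_right _ _ hV.ne', div_eq_inv_mul, mul_inv, mul_assoc, mul_comm B]
      gcongr
      exact hB _
  refine (hlim.const_mul m).congr fun i => ?_
  simp only [smul_eq_mul, mul_assoc, integral_const_mul]
  field_simp

end Smoothing

section Consistency

variable {d : ℕ} {f K : EuclideanSpace ℝ (Fin d) → ℝ} {h : ℕ → ℝ}

/-- The law of a random vector with density `f`. -/
noncomputable abbrev densityMeasure (f : EuclideanSpace ℝ (Fin d) → ℝ) :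
    Measure (EuclideanSpace ℝ (Fin d)) :=
  volume.withDensity fun x => ENNReal.ofReal (f x)

theorem IsDensity.integrable (hf : IsDensity f) : Integrable f := by
  refine ⟨hf.measurable.aestronglyMeasurable, ?_⟩
  rw [hasFiniteIntegral_iff_ofReal (ae_of_all _ hf.nonneg), hf.lintegral_eq_one]
  exact ENNReal.one_lt_top

theorem IsDensity.integral_densityMeasure (hf : IsDensity f)
    (g : EuclideanSpace ℝ (Fin d) → ℝ) :
    ∫ y, g y ∂densityMeasure f = ∫ y, g y * f y := by
  rw [integral_withDensity_eq_integral_toReal_smul hf.measurable.ennreal_ofReal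
    (ae_of_all _ fun _ => ENNReal.ofReal_lt_top)]
  simp only [ENNReal.toReal_ofReal (hf.nonneg _), smul_eq_mul, mul_comm]

theorem kernelEstimator_eq_sum_div (b : ℝ) (x : ℕ → EuclideanSpace ℝ (Fin d)) (n : ℕ)
    (z : EuclideanSpace ℝ (Fin d)) :
    kernelEstimator K b x n z = (∑ i ∈ Finset.range n, K (b⁻¹ • (z - x i))) / (n * b ^ d) :=
  one_div_mul_eq_div _ _

theorem IsBoundedKernel.tendsto_kernelEstimator_update (hK : IsBoundedKernel K)
    (hh : Tendsto (fun n : ℕ => 1 / (n * h n ^ d)) atTop (𝓝 0))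
    {x : ℕ → EuclideanSpace ℝ (Fin d)} {z : EuclideanSpace ℝ (Fin d)} {y : ℝ}
    (hx : Tendsto (fun n => kernelEstimator K (h n) x n z) atTop (𝓝 y)) (i : ℕ)
    (c : EuclideanSpace ℝ (Fin d)) :
    Tendsto (fun n => kernelEstimator K (h n) (Function.update x i c) n z) atTop (𝓝 y) := by
  obtain ⟨B, hB⟩ := hK.bounded
  have hdiff : Tendsto (fun n : ℕ => 1 / (n * h n ^ d) *
      (K ((h n)⁻¹ • (z - c)) - K ((h n)⁻¹ • (z - x i)))) atTop (𝓝 0) := by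
    refine hh.zero_mul_isBoundedUnder_le ⟨B + B, eventually_map.2 (.of_forall fun n => ?_)⟩
    exact (abs_sub _ _).trans (add_le_add (hB _) (hB _))
  refine (add_zero y ▸ hx.add hdiff).congr' ?_
  filter_upwards [eventually_gt_atTop i] with n hn
  have hi : i ∈ Finset.range n := Finset.mem_range.2 hn
  have hrest : ∑ j ∈ Finset.range n \ {i}, K ((h n)⁻¹ • (z - Function.update x i c j)) =
      ∑ j ∈ Finset.range n \ {i}, K ((h n)⁻¹ • (z - x j)) :=
    Finset.sum_congr rfl fun j hj => by
      rw [Function.update_of_ne (by simpa using (Finset.mem_sdiff.1 hj).2)]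
  simp only [kernelEstimator, Finset.sum_eq_add_sum_sdiff_singleton_of_mem hi, hrest,
    Function.update_self]
  ring

variable {Ω : Type*} [MeasurableSpace Ω] {P : Measure Ω}
  {X : ℕ → Ω → EuclideanSpace ℝ (Fin d)}

theorem IsRandomSample.integral_comp (hX : IsRandomSample P X f) (hf : IsDensity f)
    {g : EuclideanSpace ℝ (Fin d) → ℝ} (hg : Measurable g) (j : ℕ) :
    ∫ ω, g (X j ω) ∂P = ∫ y, g y * f y := by
  rw [← hf.integral_densityMeasure, densityMeasure, ← hX.law j,
    integral_map (hX.measurable j).aemeasurable hg.aestronglyMeasurable]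

variable [IsProbabilityMeasure P]

theorem IsRandomSample.isBigO_sum_variance (hX : IsRandomSample P X f) (hf : IsDensity f)
    (hK : Measurable K) (hh : ∀ᶠ n in atTop, h n ≠ 0) {x : EuclideanSpace ℝ (Fin d)} {c : ℝ}
    (hsq : Tendsto (fun n => (h n ^ d)⁻¹ * ∫ y, K ((h n)⁻¹ • (x - y)) ^ 2 * f y) atTop (𝓝 c)) :
    (fun n => ∑ j ∈ Finset.range n, Var[fun ω => K ((h n)⁻¹ • (x - X j ω)); P])
      =O[atTop] fun n : ℕ => n * h n ^ d := by
  have hmeas (n : ℕ) : Measurable fun y => K ((h n)⁻¹ • (x - y)) := by fun_prop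
  have hmoment : (fun n : ℕ => n * ∫ y, K ((h n)⁻¹ • (x - y)) ^ 2 * f y)
      =O[atTop] fun n : ℕ => n * h n ^ d := by
    refine ((isBigO_refl (fun n : ℕ => n * h n ^ d) _).mul (hsq.isBigO_one ℝ)).congr'
      (hh.mono fun n hn => ?_) (.of_forall fun n => mul_one _)
    field_simp
  refine .trans (.of_norm_le fun n => ?_) hmoment
  rw [Real.norm_of_nonneg (Finset.sum_nonneg fun j _ => variance_nonneg _ _)]
  calc ∑ j ∈ Finset.range n, Var[fun ω => K ((h n)⁻¹ • (x - X j ω)); P]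
      ≤ ∑ j ∈ Finset.range n, ∫ ω, K ((h n)⁻¹ • (x - X j ω)) ^ 2 ∂P :=
        Finset.sum_le_sum fun j _ => variance_le_expectation_sq
          (X := fun ω => K ((h n)⁻¹ • (x - X j ω)))
          ((hmeas n).comp (hX.measurable j)).aestronglyMeasurable
    _ = n * ∫ y, K ((h n)⁻¹ • (x - y)) ^ 2 * f y := by
        simp only [hX.integral_comp hf ((hmeas n).pow_const 2), Finset.sum_const,
          Finset.card_range, nsmul_eq_mul]

theorem IsRandomSample.ae_ae_tendsto_kernelEstimator (hX : IsRandomSample P X f)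
    (hf : IsDensity f) (hK : IsBoundedKernel K) (hK₁ : ∫ z, K z = 1)
    (hh : Tendsto h atTop (𝓝[>] 0))
    (hlog : (fun n : ℕ => Real.log n) =o[atTop] fun n : ℕ => n * h n ^ d) :
    ∀ᵐ x, ∀ᵐ ω ∂P, Tendsto (fun n => kernelEstimator K (h n) (fun i => X i ω) n x) atTop
      (𝓝 (f x)) := by
  have hloc := hf.integrable.locallyIntegrable
  have hK₀ : ∫ z, K z ≠ 0 := hK₁ ▸ one_ne_zero
  filter_upwards [hK.ae_tendsto_inv_pow_mul_integral hK₀ hloc hh,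
    hK.sq.ae_tendsto_inv_pow_mul_integral (hK.integral_sq_ne_zero hK₀) hloc hh] with x hmean hsq
  rw [finrank_euclideanSpace_fin] at hmean hsq
  rw [hK₁, one_mul] at hmean
  have hKm := hK.measurable
  have hmeas (n : ℕ) : Measurable fun y => K ((h n)⁻¹ • (x - y)) := by fun_prop
  have hYmean (n j : ℕ) : ∫ ω, K ((h n)⁻¹ • (x - X j ω)) ∂P =
    ∫ y, K ((h n)⁻¹ • (x - y)) * f y := hX.integral_comp hf (hmeas n) j
  have hvar := hX.isBigO_sum_variance hf hKm
    ((tendsto_nhdsWithin_iff.1 hh).2.mono fun n hn => ne_of_gt hn) hsq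
  obtain ⟨B, hB⟩ := hK.bounded
  have hdev := ae_tendsto_sum_sub_integral_div (P := P)
    (Y := fun n j ω => K ((h n)⁻¹ • (x - X j ω)))
    (fun n => hX.indep.comp (fun _ y => K ((h n)⁻¹ • (x - y))) fun _ => hmeas n)
    (fun n j => (hmeas n).comp (hX.measurable j)) (fun n j ω => hB _) hvar hlog
  filter_upwards [hdev] with ω hω
  refine (zero_add (f x) ▸ hω.add hmean).congr' ?_
  filter_upwards [eventually_gt_atTop 0] with n hn
  simp only [hYmean, Finset.sum_sub_distrib, Finset.sum_const, Finset.card_range, nsmul_eq_mul,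
    kernelEstimator_eq_sum_div]
  have : (n : ℝ) ≠ 0 := by positivity
  rw [sub_div, mul_div_mul_left _ _ this, div_eq_inv_mul _ (h n ^ d), sub_add_cancel]

theorem IsRandomSample.ae_forall_tendsto_kernelEstimator_sample (hX : IsRandomSample P X f)
    (hf : IsDensity f) (hK : IsBoundedKernel K) (hK₁ : ∫ z, K z = 1)
    (hh : Tendsto h atTop (𝓝[>] 0))
    (hlog : (fun n : ℕ => Real.log n) =o[atTop] fun n : ℕ => n * h n ^ d) :
    ∀ᵐ ω ∂P, ∀ i, Tendsto (fun n => kernelEstimator K (h n) (fun j => X j ω) n (X i ω)) atTop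
      (𝓝 (f (X i ω))) := by
  have hinv : Tendsto (fun n : ℕ => 1 / (n * h n ^ d)) atTop (𝓝 0) := by
    refine (IsLittleO.trans ?_ hlog).tendsto_div_nhds_zero
    exact isLittleO_const_left_of_ne one_ne_zero |>.2
      (tendsto_norm_atTop_atTop.comp (Real.tendsto_log_atTop.comp tendsto_natCast_atTop_atTop))
  refine ae_all_iff.2 fun i => ?_
  let A : Set (EuclideanSpace ℝ (Fin d) × (ℕ → EuclideanSpace ℝ (Fin d))) :=
    {q | Tendsto (fun n => kernelEstimator K (h n) q.2 n q.1) atTop (𝓝 (f q.1))}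
  have hA : MeasurableSet A := by
    have hKm := hK.measurable
    have hfm := hf.measurable
    refine measurableSet_tendsto_fun (fun n => ?_) (by fun_prop)
    unfold kernelEstimator
    fun_prop
  have hupdate : ∀ᵐ ω ∂P, (X i ω, Function.update (fun j => X j ω) i 0) ∈ A := by
    refine ae_prodMk_mem_of_indepFun (hX.measurable i) ?_
      (indepFun_update hX.measurable hX.indep i 0) hA ?_
    · have hXm := hX.measurable
      fun_prop
    · rw [hX.law i]
      refine (withDensity_absolutelyContinuous _ _).ae_le ?_
      filter_upwards [hX.ae_ae_tendsto_kernelEstimator hf hK hK₁ hh hlog] with y hy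
      exact hy.mono fun ω hω => hK.tendsto_kernelEstimator_update hinv hω i 0
  filter_upwards [hupdate] with ω hω
  simpa using hK.tendsto_kernelEstimator_update hinv hω i (X i ω)

end Consistency

section Approximation

theorem isCompact_truncated_hypograph {E : Type*} [TopologicalSpace E] [T2Space E] {f : E → ℝ}
    {l u : ℝ} (hf : ∀ t ∈ Icc l u, IsCompact {x | t ≤ f x}) :
    IsCompact {q : E × ℝ | q.2 ∈ Icc l u ∧ q.2 ≤ f q.1} := by
  rcases lt_or_ge u l with hul | hlu
  · simp [Icc_eq_empty_of_lt hul]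
  have heq : {q : E × ℝ | q.2 ∈ Icc l u ∧ q.2 ≤ f q.1} = ({x | l ≤ f x} ×ˢ Icc l u) ∩
      ⋂ s ∈ Icc l u, (Prod.snd ⁻¹' Iic s ∪ Prod.fst ⁻¹' {x | s ≤ f x}) := by
    ext ⟨x, t⟩
    simp only [mem_ofPred_eq, mem_inter_iff, mem_prod, mem_iInter, mem_union, mem_preimage,
      mem_Iic]
    refine ⟨fun ⟨ht, htx⟩ => ⟨⟨ht.1.trans htx, ht⟩, fun s _ =>
      (le_total t s).imp_right fun hst => hst.trans htx⟩, fun ⟨⟨hlx, ht⟩, hs⟩ => ⟨ht, ?_⟩⟩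
    by_contra! hlt
    obtain ⟨s, hxs, hst⟩ := exists_between hlt
    exact (hs s ⟨(hlx.trans_lt hxs).le, hst.le.trans ht.2⟩).elim hst.not_ge hxs.not_ge
  rw [heq]
  refine ((hf l ⟨le_rfl, hlu⟩).prod isCompact_Icc).inter_right (isClosed_biInter fun s hs => ?_)
  exact (isClosed_Iic.preimage continuous_snd).union ((hf s hs).isClosed.preimage continuous_fst)

theorem eventually_exists_sample_near {E : Type*} [MetricSpace E] {f : E → ℝ} {l u : ℝ}
    (hf : ∀ t ∈ Icc l u, IsCompact {y | t ≤ f y}) {x : ℕ → E}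
    (hdense : ∀ t ∈ Icc l u, {y | t ≤ f y} ⊆ closure (x '' {i | t < f (x i)}))
    {g : ℕ → E → ℝ} (hg : ∀ i, Tendsto (fun n => g n (x i)) atTop (𝓝 (f (x i))))
    {D : ℕ → ℝ} (hD : Tendsto D atTop (𝓝 0)) {ε : ℝ} (hε : 0 < ε) :
    ∀ᶠ n in atTop, ∀ t ∈ Icc l u, ∀ y, t ≤ f y →
      ∃ i < n, t + D n ≤ g n (x i) ∧ dist y (x i) < ε := by
  have hlocal : {p : ℕ × (E × ℝ) |
      ∃ i < p.1, p.2.2 + D p.1 ≤ g p.1 (x i) ∧ dist p.2.1 (x i) < ε} ∈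
      atTop ×ˢ 𝓝ˢ {q : E × ℝ | q.2 ∈ Icc l u ∧ q.2 ≤ f q.1} := by
    refine (isCompact_truncated_hypograph hf).mem_prod_nhdsSet_of_forall fun q hq => ?_
    obtain ⟨_, ⟨i, hi, rfl⟩, hyi⟩ := Metric.mem_closure_iff.1 (hdense q.2 hq.1 hq.2) ε hε
    have hlevel : ∀ᶠ p : ℕ × (E × ℝ) in atTop ×ˢ 𝓝 q, p.2.2 + D p.1 < g p.1 (x i) := by
      refine Tendsto.eventually_lt ?_ ((hg i).comp tendsto_fst) hi
      simpa using ((continuous_snd.tendsto q).comp tendsto_snd).add (hD.comp tendsto_fst)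
    have hnear : ∀ᶠ p : ℕ × (E × ℝ) in atTop ×ˢ 𝓝 q, dist p.2.1 (x i) < ε :=
      (((continuous_fst.dist continuous_const).tendsto q).comp tendsto_snd).eventually_lt_const
        hyi
    filter_upwards [hlevel, hnear, tendsto_fst.eventually (eventually_gt_atTop i)]
      with p hp hpi hlt using ⟨i, hlt, hp.le, hpi⟩
  filter_upwards [Eventually.curry hlocal] with n hn t ht y hty
  exact hn.self_of_nhdsSet (y, t) ⟨ht, hty⟩

end Approximation

section Support

theorem mem_closure_interior_lt_of_not_isLocalMax {E : Type*} [TopologicalSpace E] {f : E → ℝ}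
    {x : E} (hf : ∀ᶠ y in 𝓝 x, ContinuousAt f y) (hx : ¬ IsLocalMax f x) :
    x ∈ closure (interior {y | f x < f y}) := by
  have hfreq : ∃ᶠ y in 𝓝 x, f x < f y := by
    simpa only [IsLocalMax, IsMaxFilter, not_eventually, not_le] using hx
  refine mem_closure_iff_frequently.2 ((hfreq.and_eventually hf).mono fun y hy => ?_)
  exact mem_interior_iff_mem_nhds.2 (hy.2.eventually_const_lt hy.1)

variable {d p : ℕ} {f : EuclideanSpace ℝ (Fin d) → ℝ} {l u : ℝ}

theorem AssumptionA.levelSet_subset_closure_interior (hA : AssumptionA f l u p) {t : ℝ}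
    (ht : t ∈ Icc l u) : levelSet f t ⊆ closure (interior {y | t < f y}) := by
  obtain ⟨ζ, hζ, U, hUo, -, hU, -, hC, ⟨m, hm, hgrad⟩, -⟩ := hA.regular
  intro x hx
  by_cases hxU : x ∈ U
  · have hcont : ∀ᶠ y in 𝓝 x, ContinuousAt f y := (hUo.eventually_mem hxU).mono fun y hy =>
      hC.continuousOn.continuousAt (hUo.mem_nhds hy)
    have hmax : ¬ IsLocalMax f x := fun hloc => by
      have := hgrad x hxU
      simp only [gradient, hloc.fderiv_eq_zero, map_zero, norm_zero] at this
      exact hm.not_ge this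
    refine closure_mono (interior_mono fun y hy => ?_)
      (mem_closure_interior_lt_of_not_isLocalMax hcont hmax)
    exact lt_of_le_of_lt hx (mem_ofPred_eq ▸ hy)
  · have hlow : x ∈ closure (levelSet f (l - ζ)) :=
      subset_closure (show l - ζ ≤ f x from (by linarith [ht.1] : l - ζ ≤ t).trans hx)
    have hhigh : x ∈ interior (levelSet f (u + ζ)) := by
      by_contra hn
      exact hxU (hU ⟨hlow, hn⟩)
    refine subset_closure (interior_mono (fun y hy => ?_) hhigh)
    exact lt_of_lt_of_le (by linarith [ht.2]) (show u + ζ ≤ f y from hy)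

theorem closure_interior_subset_support_densityMeasure (hf : Measurable f) {t : ℝ}
    (ht : 0 ≤ t) : closure (interior {y | t < f y}) ⊆
      ((densityMeasure f).restrict {y | t < f y}).support := by
  have hmeas : MeasurableSet {y | t < f y} := measurableSet_lt measurable_const hf
  refine closure_minimal (fun x hx => ?_) Measure.isClosed_support
  refine (Measure.mem_support_iff_forall x).2 fun U hU => ?_
  have hpos : 0 < volume (U ∩ {y | t < f y}) := Measure.measure_pos_of_mem_nhds volume
    (inter_mem hU (mem_interior_iff_mem_nhds.1 hx))
  have hsub : U ∩ {y | t < f y} ⊆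
      {x | ENNReal.ofReal (f x) ≠ 0} ∩ (U ∩ {y | t < f y}) := fun y hy =>
    ⟨(ENNReal.ofReal_pos.2 (ht.trans_lt hy.2)).ne', hy⟩
  rw [Measure.restrict_apply' hmeas, pos_iff_ne_zero, Ne,
    withDensity_apply_eq_zero hf.ennreal_ofReal]
  exact (hpos.trans_le (measure_mono hsub)).ne'

end Support

section Hypotheses

variable {d p : ℕ} {f K : EuclideanSpace ℝ (Fin d) → ℝ} {h : ℕ → ℝ}

theorem IsDensity.pos_of_not_convex (hf : IsDensity f) {t : ℝ}
    (ht : ¬ Convex ℝ (levelSet f t)) : 0 < t := by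
  by_contra! h0
  have huniv : levelSet f t = univ := eq_univ_of_forall fun x => h0.trans (hf.nonneg x)
  exact ht (huniv ▸ convex_univ)

theorem AssumptionA.levelSet_subset_support {l u : ℝ} (hA : AssumptionA f l u p)
    (hf : Measurable f) (hl : 0 ≤ l) {t : ℝ} (ht : t ∈ Icc l u) :
    levelSet f t ⊆ ((densityMeasure f).restrict {y | t < f y}).support :=
  (hA.levelSet_subset_closure_interior ht).trans
    (closure_interior_subset_support_densityMeasure hf (hl.trans ht.1))

theorem AssumptionK.isBoundedKernel (hK : AssumptionK K h p) : IsBoundedKernel K where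
  measurable := hK.continuous.measurable
  bounded := hK.continuous.bounded_above_of_compact_support
    (show HasCompactSupport K from hK.bounded_support.isCompact_closure)
  bounded_support := hK.bounded_support

theorem tendsto_log_div_rpow {a : ℝ} (ha : 0 < a) :
    Tendsto (fun n : ℕ => (Real.log n / n) ^ a) atTop (𝓝 0) := by
  have hlog : Tendsto (fun n : ℕ => Real.log n / n) atTop (𝓝 0) :=
    (Real.isLittleO_log_id_atTop.comp_tendsto tendsto_natCast_atTop_atTop).tendsto_div_nhds_zero
  simpa only [Real.zero_rpow ha.ne'] using hlog.rpow_const (Or.inr ha.le)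

theorem tendsto_gap (hp : 0 < p) (M : ℝ) : Tendsto (gap d p M) atTop (𝓝 0) := by
  have hrate := (tendsto_log_div_rpow
    (show 0 < (p : ℝ) / ((d : ℝ) + 2 * (p : ℝ)) by positivity)).const_mul M
  rwa [mul_zero] at hrate

theorem AssumptionK.tendsto_bandwidth (hK : AssumptionK K h p) (hp : 0 < p) :
    Tendsto h atTop (𝓝[>] 0) :=
  tendsto_nhdsWithin_iff.2 ⟨hK.bandwidth_order.1.trans_tendsto
    (tendsto_log_div_rpow (by positivity)), hK.bandwidth_pos⟩

theorem AssumptionK.isLittleO_log (hK : AssumptionK K h p) (hp : 0 < p) :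
    (fun n : ℕ => Real.log n) =o[atTop] fun n : ℕ => n * h n ^ d := by
  set q : ℝ := d + 2 * p
  have hq : 0 < q := by positivity
  have hbandwidth : (fun n : ℕ => (Real.log n / n) ^ (d / q)) =O[atTop] fun n => h n ^ d := by
    refine (hK.bandwidth_order.2.pow d).congr_left fun n => ?_
    rw [← Real.rpow_mul_natCast (by positivity), one_div_mul_eq_div]
  have hsmall : (fun n : ℕ => (Real.log n / n) ^ (2 * p / q)) =o[atTop] fun _ => (1 : ℝ) :=
    (isLittleO_one_iff ℝ).2 (tendsto_log_div_rpow (by positivity))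
  refine ((hsmall.mul_isBigO ((isBigO_refl (fun n : ℕ => (n : ℝ)) _).mul hbandwidth)).congr'
    ?_ (.of_forall fun n => one_mul _))
  filter_upwards [eventually_gt_atTop 1] with n hn
  have hlog : 0 < Real.log n := Real.log_pos (by exact_mod_cast hn)
  have hexp : 2 * p / q + d / q = 1 := by
    rw [← add_div, add_comm, div_self hq.ne']
  rw [mul_left_comm, ← Real.rpow_add (by positivity), hexp, Real.rpow_one]
  field_simp

end Hypotheses

end LevelSetEstimation

open LevelSetEstimation in
theorem proposition2p2_general {d : ℕ} {f K : EuclideanSpace ℝ (Fin d) → ℝ} {l u : ℝ}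
    {h D : ℕ → ℝ} (hf : IsDensity f) (hcompact : ∀ t ∈ Icc l u, IsCompact (levelSet f t))
    (hsupp : ∀ t ∈ Icc l u,
      levelSet f t ⊆ ((densityMeasure f).restrict {y | t < f y}).support)
    (hu : (levelSet f u).Nonempty) (hK : IsBoundedKernel K) (hK₁ : ∫ z, K z = 1)
    (hh : Tendsto h atTop (𝓝[>] 0))
    (hlog : (fun n : ℕ => Real.log n) =o[atTop] fun n : ℕ => n * h n ^ d)
    (hD : Tendsto D atTop (𝓝 0)) {Ω : Type*} [MeasurableSpace Ω] {P : Measure Ω}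
    [IsProbabilityMeasure P] {X : ℕ → Ω → EuclideanSpace ℝ (Fin d)}
    (hX : IsRandomSample P X f) :
    ∀ᵐ ω ∂P, Tendsto (fun n => ⨆ t ∈ Icc l u, ⨆ x ∈ levelSet f t,
        Metric.infEDist x (plusSample K (h n) (D n) (fun i => X i ω) n t)) atTop (𝓝 0) ∧
      ∀ᶠ n in atTop, ∀ t ∈ Icc l u,
        (plusSample K (h n) (D n) (fun i => X i ω) n t).Nonempty := by
  filter_upwards [ae_forall_support_restrict_subset_closure_image hX.measurable hX.indep hX.law
      hf.measurable, hX.ae_forall_tendsto_kernelEstimator_sample hf hK hK₁ hh hlog]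
    with ω hdense hconsistent
  have hnear {ε : ℝ} (hε : 0 < ε) := eventually_exists_sample_near hcompact
    (fun t ht => (hsupp t ht).trans (hdense t)) hconsistent hD hε
  constructor
  · refine ENNReal.tendsto_nhds_zero.2 fun ε hε => ?_
    obtain ⟨δ, hδ, hδε⟩ := ENNReal.lt_iff_exists_nnreal_btwn.1 hε
    filter_upwards [hnear (NNReal.coe_pos.2 (ENNReal.coe_pos.1 hδ))] with n hn
    refine iSup₂_le fun t ht => iSup₂_le fun x hx => ?_
    obtain ⟨i, hi, hle, hdist⟩ := hn t ht x hx
    calc Metric.infEDist x (plusSample K (h n) (D n) (fun i => X i ω) n t)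
        ≤ edist x (X i ω) := Metric.infEDist_le_edist_of_mem ⟨⟨i, hi, rfl⟩, hle⟩
      _ ≤ δ := (edist_lt_coe.2 hdist).le
      _ ≤ ε := hδε.le
  · filter_upwards [hnear one_pos] with n hn t ht
    obtain ⟨y, hy⟩ := hu
    obtain ⟨i, hi, hle, -⟩ := hn t ht y (ht.2.trans hy)
    exact ⟨X i ω, ⟨i, hi, rfl⟩, hle⟩

theorem proposition2p2 {d p : ℕ} (f : EuclideanSpace ℝ (Fin d) → ℝ) (l u : ℝ)
    (K : EuclideanSpace ℝ (Fin d) → ℝ) (h : ℕ → ℝ)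
    (hf : LevelSetEstimation.IsDensity f)
    (hA : LevelSetEstimation.AssumptionA f l u p)
    (hK : LevelSetEstimation.AssumptionK K h p)
    (hG : ∀ t ∈ Set.Icc l u, IsCompact (LevelSetEstimation.levelSet f t) ∧
      (LevelSetEstimation.levelSet f t).Nonempty ∧
      ¬ Convex ℝ (LevelSetEstimation.levelSet f t)) :
    ∃ M₀ > 0, ∀ M ≥ M₀,
      ∀ {Ω : Type*} [MeasurableSpace Ω] (P : Measure Ω) [IsProbabilityMeasure P]
        (X : ℕ → Ω → EuclideanSpace ℝ (Fin d)),
        LevelSetEstimation.IsRandomSample P X f →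
        (∀ ε : ℝ, 0 < ε → ∀ᵐ ω ∂P, ∀ᶠ n in atTop,
          (⨆ t ∈ Set.Icc l u, ⨆ x ∈ LevelSetEstimation.levelSet f t,
            Metric.infEDist x (LevelSetEstimation.plusSample K (h n)
              (LevelSetEstimation.gap d p M n) (fun i => X i ω) n t)) ≤ ENNReal.ofReal ε) ∧
        (∀ᵐ ω ∂P, ∀ᶠ n in atTop, ∀ t ∈ Set.Icc l u,
          (LevelSetEstimation.plusSample K (h n)
            (LevelSetEstimation.gap d p M n) (fun i => X i ω) n t).Nonempty) := by
  have hp := hA.one_le_p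
  have hl := hf.pos_of_not_convex (hG l ⟨le_rfl, hA.l_le_u⟩).2.2
  refine ⟨1, one_pos, fun M _ Ω _ P _ X hX => ?_⟩
  have key := proposition2p2_general hf (fun t ht => (hG t ht).1)
    (fun t => hA.levelSet_subset_support hf.measurable hl.le) (hG u ⟨hA.l_le_u, le_rfl⟩).2.1
    hK.isBoundedKernel hK.order.integral_eq_one (hK.tendsto_bandwidth hp) (hK.isLittleO_log hp)
    (LevelSetEstimation.tendsto_gap (d := d) hp M) hX
  exact ⟨fun ε hε => key.mono fun ω hω =>
    hω.1.eventually_le_const (ENNReal.ofReal_pos.2 hε), key.mono fun ω hω => hω.2⟩
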